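/- Let $k$ be an algebraically closed field. A variety is a reduced separated scheme of finite type over $k$ (not necessarily irreducible), identified with its set of closed points with the Zariski topology. Let $X$ be an irreducible variety, and let $\mathrm{Bir}(X)$ be the group of birational maps $X\dashrightarrow X$ over $k$. For a variety $T$, a map $\varphi:T\to\mathrm{Bir}(X)$, $t\mapsto\varphi_t$, is called a morphism if there are a dense open subset $U\subset T\times X$ and a morphism $f:U\to X$ such that $(t,x)\mapsto (t,f(t,x))$ defines a birational map of $T\times X$ and, for every $t\in T$, the set $U_t=\{x\in X : (t,x)\in U\}$ is dense in $X$ and $U_t\to X$, $x\mapsto f(t,x)$, is a birational morphism representing $\varphi_t$. The Zariski topology on $\mathrm{Bir}(X)$ is the one in which a subset is closed if and only if its preimage under every morphism $T\to\mathrm{Bir}(X)$, for every variety $T$, is closed in $T$. A subset of a topological space is constructible if it is a finite union of locally closed subsets. Theorem. Let $X$ be a rational variety (that is, birational over $k$ to an affine, equivalently projective, space), let $T$ be a variety, let $\varphi:T\to\mathrm{Bir}(X)$ be a morphism and let $C\subset T$ be a constructible set. Then $\varphi(C)$ is constructible in $\mathrm{Bir}(X)$, and it contains a dense open subset of its closure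 $\overline{\varphi(C)}$ (taken in $\mathrm{Bir}(X)$, with the subspace topology). -/

import Mathlib

open CategoryTheory CategoryTheory.Limits AlgebraicGeometry

universe u

namespace BirFamilies

/-- `sX : X ⟶ Spec k` is an algebraic variety over the field `k` (not necessarily irreducible):
a reduced separated scheme of finite type over `k`. -/
class IsVariety {k : Type u} [Field k] {X : Scheme.{u}} (sX : X ⟶ Spec (.of k)) : Prop where
  isReduced : IsReduced X
  isSeparated : IsSeparated sX
  locallyOfFiniteType : LocallyOfFiniteType sX
  quasiCompact : QuasiCompact sX

/-- The classical points of `T`: the `k`-rational points. When `k` is algebraically closed and `T`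
is locally of finite type over `k` these are the same as the closed points of `T`. -/
def Points {k : Type u} [Field k] {T : Scheme.{u}} (sT : T ⟶ Spec (.of k)) : Type u :=
  {t : Spec (.of k) ⟶ T // t ≫ sT = 𝟙 _}

/-- The Zariski topology on the set of classical points of `T`. -/
noncomputable instance instTopologicalSpacePoints {k : Type u} [Field k] {T : Scheme.{u}}
    (sT : T ⟶ Spec (.of k)) :
    TopologicalSpace (Points sT) :=
  TopologicalSpace.induced (fun t => t.1 (IsLocalRing.closedPoint k)) inferInstance

/-- A rational map `X ⤏ Y` between `S`-schemes is birational (over `S`) if it is given by an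
`S`-isomorphism between a dense open subscheme of `X` and a dense open subscheme of `Y`. -/
def IsBirationalMap {S X Y : Scheme.{u}} (sX : X ⟶ S) (sY : Y ⟶ S) (f : X ⤏ Y) : Prop :=
  ∃ e : X.PartialIso Y, e.IsOver sX sY ∧ e.toRationalMap = f

/-- `Bir(X)`: the set of birational maps `X ⤏ X` over `S`. -/
def Bir {S X : Scheme.{u}} (sX : X ⟶ S) : Type u :=
  {f : X ⤏ X // IsBirationalMap sX sX f}

section

variable {k : Type u} [Field k] {T X : Scheme.{u}} (sT : T ⟶ Spec (.of k)) (sX : X ⟶ Spec (.of k))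

/-- The structure morphism of `T × X` over `k`. -/
noncomputable abbrev prodStr : pullback sT sX ⟶ Spec (.of k) :=
  pullback.fst sT sX ≫ sT

variable {sT}

/-- The inclusion `X ≅ {t} × X ⟶ T × X` of the fibre over a point `t` of `T`, `x ↦ (t, x)`. -/
noncomputable def fibreIncl (t : Points sT) : X ⟶ pullback sT sX :=
  pullback.lift (sX ≫ t.1) (𝟙 X) (by rw [Category.assoc, t.2]; simp)

/-- For `U` open in `T × X`, the open subset `U_t = U ∩ ({t} × X)` of `{t} × X ≅ X`. -/
noncomputable abbrev fibreOpen (t : Points sT) (U : (pullback sT sX).Opens) : X.Opens :=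
  (fibreIncl sX t) ⁻¹ᵁ U

/-- For `f : U ⟶ X`, the morphism `f_t : U_t ⟶ X`, `x ↦ f (t, x)`. -/
noncomputable def fibreHom (t : Points sT) (U : (pullback sT sX).Opens) (f : U.toScheme ⟶ X) :
    (fibreOpen sX t U).toScheme ⟶ X :=
  (fibreIncl sX t) ∣_ U ≫ f

variable (sT)

/-- A pseudo-automorphism of `T × X` over `T`, presented on an open set `U` (called `domain`): a
birational map of `T × X` defined on the dense open set `U` and of the form `(t, x) ↦ (t, f (t, x))`
there, such that for every point `t` of `T` the set `U_t` is dense in `{t} × X` and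
`x ↦ f (t, x)` is a birational morphism from `U_t` to `X`. -/
structure PseudoAut where
  /-- The dense open set `U ⊆ T × X`. -/
  domain : (pullback sT sX).Opens
  dense_domain : Dense (domain : Set ↥(pullback sT sX))
  /-- The morphism `f : U ⟶ X` over `k`. -/
  f : domain.toScheme ⟶ X
  f_over : (domain.ι ≫ pullback.fst sT sX) ≫ sT = f ≫ sX
  birational : IsBirationalMap (prodStr sT sX) (prodStr sT sX)
    (Scheme.PartialMap.toRationalMap
      { domain := domain
        dense_domain := dense_domain
        hom := pullback.lift (domain.ι ≫ pullback.fst sT sX) f f_over })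
  dense_fibre : ∀ t : Points sT, Dense (fibreOpen sX t domain : Set X)
  birational_fibre : ∀ t : Points sT, IsBirationalMap sX sX
    (Scheme.PartialMap.toRationalMap
      { domain := fibreOpen sX t domain
        dense_domain := dense_fibre t
        hom := fibreHom sX t domain f })

variable {sT sX}

/-- The family `t ↦ φ_t` of birational maps of `X` induced by a pseudo-automorphism. -/
noncomputable def PseudoAut.family (φ : PseudoAut sT sX) (t : Points sT) : Bir sX :=
  ⟨_, φ.birational_fibre t⟩

/-- A map `T → Bir(X)` is a morphism (an algebraic family of birational maps of `X`) if it is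
induced by a pseudo-automorphism of `T × X` over `T`. -/
def IsMorphism (φ : Points sT → Bir sX) : Prop :=
  ∃ Φ : PseudoAut sT sX, Φ.family = φ

/-- A subset of `Bir(X)` is closed if its preimage under every morphism `T → Bir(X)`, with `T` any
variety over `k`, is closed in `T`. -/
def IsZariskiClosed (F : Set (Bir sX)) : Prop :=
  ∀ (T : Scheme.{u}) (sT : T ⟶ Spec (.of k)), IsVariety sT →
    ∀ φ : Points sT → Bir sX, IsMorphism φ → IsClosed (φ ⁻¹' F)

/-- The Zariski topology on `Bir(X)`. -/
instance instTopologicalSpaceBir : TopologicalSpace (Bir sX) :=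
  TopologicalSpace.ofClosed {F | IsZariskiClosed F}
    (fun _ _ _ _ _ => by simp)
    (fun A hA T sT hT φ hφ => by
      rw [Set.preimage_sInter]
      exact isClosed_biInter fun F hF => hA hF T sT hT φ hφ)
    (fun F hF G hG T sT hT φ hφ => by
      rw [Set.preimage_union]
      exact (hF T sT hT φ hφ).union (hG T sT hT φ hφ))

end

/-- A subset of a topological space is constructible if it is a finite union of locally closed
subsets. -/
def IsConstructibleSet {Y : Type*} [TopologicalSpace Y] (C : Set Y) : Prop :=
  ∃ F : Set (Set Y), F.Finite ∧ (∀ Z ∈ F, IsLocallyClosed Z) ∧ C = ⋃₀ F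

end BirFamilies

/-! Let `K` be the function field of `X` and `B` the coordinate ring of an affine open subset of
`X`. A birational map `ψ` is determined by the tuple `y` of elements of `K` obtained by pulling back
finitely many generators of `B` (`Bir.ext_coordHom`). In a family, locally on an affine piece `Spec
R` of the base, these coordinates are quotients with a common denominator of elements of `R ⊗ B`
(`PseudoAut.exists_chart`). Only finitely many vectors `v a` of `K`, independent over `k`, are
needed to write the given numerators and denominator, so each parameter has a coefficient vector `x`
over `k`.

By Chevalley's theorem, the vectors `x` whose tuple of combinations of the `v a` is proportional to
that of some parameter in `C` are the rational points of a constructible set `Q`. To move this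
condition to `Bir(X)`, note that "`x` represents `(1, y)` up to a factor" is a linear system in `x`.
Requiring some coordinates to vanish and one to be `1` makes its solution unique
(`exists_injective_system`). In every family the system has regular coefficients after clearing
denominators, so by Cramer's rule the locus "degenerate, or with a solution satisfying given
equations" is closed in `Bir(X)` (`isClosed_solutionLocus`). Finitely many differences of such loci
make up the image (`isConstructibleSet_of_chart`), and quasi-compactness of `T` reduces the theorem
to charts.

The dense open subset exists for constructible sets in any topological space. -/

namespace BirFamilies

/-! ### Constructible sets in a topological space -/

section Topology

variable {Y Z : Type*} [TopologicalSpace Y] [TopologicalSpace Z]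

theorem IsConstructibleSet.sUnion {F : Set (Set Y)} (hF : F.Finite)
    (h : ∀ A ∈ F, IsConstructibleSet A) : IsConstructibleSet (⋃₀ F) := by
  choose! G hG₁ hG₂ hG₃ using h
  refine ⟨⋃ A ∈ F, G A, hF.biUnion hG₁, ?_, ?_⟩
  · intro Z hZ
    obtain ⟨A, hA, hZA⟩ := Set.mem_iUnion₂.mp hZ
    exact hG₂ A hA Z hZA
  · ext x
    simp only [Set.mem_sUnion, Set.mem_iUnion]
    constructor
    · rintro ⟨A, hA, hx⟩
      rw [hG₃ A hA] at hx
      obtain ⟨Z, hZ, hx⟩ := hx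
      exact ⟨Z, ⟨A, hA, hZ⟩, hx⟩
    · rintro ⟨Z, ⟨A, hA, hZ⟩, hx⟩
      refine ⟨A, hA, ?_⟩
      rw [hG₃ A hA]
      exact ⟨Z, hZ, hx⟩

theorem IsConstructibleSet.iUnion {ι : Type*} [Finite ι] {A : ι → Set Y}
    (h : ∀ i, IsConstructibleSet (A i)) : IsConstructibleSet (⋃ i, A i) := by
  rw [← Set.sUnion_range]
  exact .sUnion (Set.finite_range A) (by rintro _ ⟨i, rfl⟩; exact h i)

theorem _root_.IsLocallyClosed.isConstructibleSet {A : Set Y} (h : IsLocallyClosed A) :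
    IsConstructibleSet A :=
  ⟨{A}, Set.finite_singleton A, by simpa using h, by simp⟩

theorem IsConstructibleSet.preimage {f : Y → Z} (hf : Continuous f) {A : Set Z}
    (hA : IsConstructibleSet A) : IsConstructibleSet (f ⁻¹' A) := by
  obtain ⟨F, hF, hF', rfl⟩ := hA
  rw [Set.preimage_sUnion, Set.biUnion_eq_iUnion]
  have := hF.to_subtype
  exact .iUnion fun Z => ((hF' Z Z.2).preimage hf).isConstructibleSet

theorem IsConstructibleSet.inter_isLocallyClosed {A B : Set Y} (hA : IsConstructibleSet A)
    (hB : IsLocallyClosed B) : IsConstructibleSet (A ∩ B) := by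
  obtain ⟨F, hF, hF', rfl⟩ := hA
  rw [Set.sUnion_eq_iUnion, Set.iUnion_inter]
  have := hF.to_subtype
  exact .iUnion fun Z => ((hF' Z Z.2).inter hB).isConstructibleSet

/-- A constructible set for an induced topology is the preimage of a constructible set. -/
theorem IsConstructibleSet.exists_preimage_eq {f : Y → Z} (hf : Topology.IsInducing f) {A : Set Y}
    (hA : IsConstructibleSet A) : ∃ B : Set Z, IsConstructibleSet B ∧ f ⁻¹' B = A := by
  obtain ⟨F, hF, hF', rfl⟩ := hA
  have key : ∀ A ∈ F, ∃ B : Set Z, IsLocallyClosed B ∧ f ⁻¹' B = A := by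
    intro A hA
    obtain ⟨U, V, hU, hV, rfl⟩ := hF' A hA
    obtain ⟨U', hU', rfl⟩ := hf.isOpen_iff.mp hU
    obtain ⟨V', hV', rfl⟩ := hf.isClosed_iff.mp hV
    exact ⟨U' ∩ V', ⟨U', V', hU', hV', rfl⟩, rfl⟩
  choose! G hG₁ hG₂ using key
  refine ⟨⋃₀ (G '' F), .sUnion (hF.image G) ?_, ?_⟩
  · rintro _ ⟨A, hA, rfl⟩
    exact (hG₁ A hA).isConstructibleSet
  · rw [Set.sUnion_image, Set.preimage_iUnion₂, Set.sUnion_eq_biUnion]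
    exact Set.iUnion₂_congr hG₂

theorem IsConstructibleSet.isConstructible [TopologicalSpace.NoetherianSpace Y] {A : Set Y}
    (hA : IsConstructibleSet A) : Topology.IsConstructible A := by
  have hopen : ∀ U : Set Y, IsOpen U → Topology.IsConstructible U := fun U hU =>
    IsRetrocompact.isConstructible hU
      fun V _ _ => TopologicalSpace.NoetherianSpace.isCompact _
  obtain ⟨F, hF, hF', rfl⟩ := hA
  refine .sUnion hF fun Z hZ => ?_
  obtain ⟨U, V, hU, hV, rfl⟩ := hF' Z hZ
  exact (hopen U hU).inter (Topology.isConstructible_compl.mp (hopen _ hV.isOpen_compl))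

/-- Induction on the cover: if `W` is not inside `Z`, the nonempty open set `W \ Z` is covered by
the remaining members. -/
theorem _root_.Set.Finite.exists_mem_inter_interior {F : Set (Set Y)} (hF : F.Finite)
    (hcl : ∀ Z ∈ F, IsClosed Z) {W : Set Y} (hW : IsOpen W) (hne : W.Nonempty) (hWF : W ⊆ ⋃₀ F) :
    ∃ Z ∈ F, (W ∩ interior Z).Nonempty := by
  induction F, hF using Set.Finite.induction_on generalizing W with
  | empty =>
    obtain ⟨w, hw⟩ := hne
    simpa using hWF hw
  | @insert Z F _ _ ih =>
    by_cases h : W ⊆ Z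
    · obtain ⟨w, hw⟩ := hne
      exact ⟨Z, by simp, w, hw, mem_interior.mpr ⟨W, h, hW, hw⟩⟩
    · obtain ⟨w, hw, hwZ⟩ := Set.not_subset.mp h
      obtain ⟨Z', hZ', v, hv, hvZ⟩ := ih (fun Z' hZ' => hcl Z' (by simp [hZ']))
        (hW.sdiff (hcl Z (by simp))) ⟨w, hw, hwZ⟩ (by
          rintro x ⟨hx, hxZ⟩
          have := hWF hx
          rw [Set.sUnion_insert] at this
          exact this.resolve_left hxZ)
      exact ⟨Z', by simp [hZ'], v, hv.1, hvZ⟩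

/-- A constructible set contains a dense open subset of its closure. -/
theorem IsConstructibleSet.exists_isOpen_dense {A : Set Y} (hA : IsConstructibleSet A) :
    ∃ O : Set ↥(closure A), IsOpen O ∧ Dense O ∧ Subtype.val '' O ⊆ A := by
  obtain ⟨F, hF, hF', rfl⟩ := hA
  set A := ⋃₀ F with hAdef
  set C : Set ↥(closure A) := Subtype.val ⁻¹' A
  refine ⟨interior C, isOpen_interior, ?_, ?_⟩
  swap
  · rintro _ ⟨x, hx, rfl⟩
    exact (interior_subset hx : x ∈ C)
  rw [dense_iff_inter_open]
  rintro W hW ⟨w, hw⟩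
  have hcl : ∀ Z ∈ F, Z ⊆ A := fun Z hZ => Set.subset_sUnion_of_mem hZ
  -- The closures of the pieces cover `closure A`, so the interior of one of them meets `W`. In that
  -- open set `G` the piece `Z = U ∩ V` is dense, and `G ∩ U` lies in `Z` because `closure Z ⊆ V`.
  obtain ⟨_, ⟨Z, hZ, rfl⟩, y, hyW, hy⟩ := (hF.image fun Z : Set Y =>
    (Subtype.val ⁻¹' closure Z : Set ↥(closure A))).exists_mem_inter_interior (by
      rintro _ ⟨Z, -, rfl⟩
      exact isClosed_closure.preimage continuous_subtype_val) hW ⟨w, hw⟩ (by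
      rintro ⟨x, hx⟩ -
      rw [hAdef, hF.closure_sUnion] at hx
      simpa using hx)
  obtain ⟨U, V, hU, hV, hUV⟩ := hF' Z hZ
  set G := W ∩ interior (Subtype.val ⁻¹' closure Z : Set ↥(closure A))
  have hG : IsOpen G := hW.inter isOpen_interior
  obtain ⟨G', hG', hGG⟩ := isOpen_induced_iff.mp hG
  have hyG : (y : Y) ∈ G' := by
    have : y ∈ Subtype.val ⁻¹' G' := by rw [hGG]; exact ⟨hyW, hy⟩
    exact this
  have hyZ : (y : Y) ∈ closure Z := (interior_subset hy : _)
  obtain ⟨z, hzG, hzZ⟩ := mem_closure_iff.mp hyZ G' hG' hyG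
  have hzA : z ∈ closure A := subset_closure (hcl Z hZ hzZ)
  have hz' : (⟨z, hzA⟩ : ↥(closure A)) ∈ G := by
    rw [← hGG]; exact hzG
  refine ⟨⟨z, hzA⟩, hz'.1, ?_⟩
  refine mem_interior.mpr ⟨G ∩ Subtype.val ⁻¹' U, ?_, hG.inter (hU.preimage continuous_subtype_val),
    hz', ?_⟩
  · rintro x ⟨hxG, hxU⟩
    have hxV : (x : Y) ∈ closure Z := (interior_subset hxG.2 : _)
    have : closure Z ⊆ V := hV.closure_subset_iff.mpr (hUV ▸ Set.inter_subset_right)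
    exact hcl Z hZ (by rw [hUV]; exact ⟨hxU, this hxV⟩)
  · rw [hUV] at hzZ
    exact hzZ.1

end Topology

/-! ### Regular families of linear systems -/

section Linear

variable {k S R F I : Type*} [Field k] [CommRing R] [Algebra k R]
  [AddCommGroup F] [Module k F]

/-- A vector-valued function on a family of `k`-points of `Spec R` is regular if all its
coordinate functions are given by elements of `R`. -/
def IsRegularVec (ev : S → R →ₐ[k] k) (w : S → F) : Prop :=
  ∀ l : Module.Dual k F, ∃ r : R, ∀ s, l (w s) = ev s r

theorem exists_clear_denominators (ev : S → R →ₐ[k] k) (d : R) (H : I → R)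
    (P : MvPolynomial I k) : ∃ (n : ℕ) (r : R), ∀ s, ev s d ≠ 0 →
      ev s r = ev s d ^ n * MvPolynomial.eval (fun i => ev s (H i) / ev s d) P := by
  induction P using MvPolynomial.induction_on with
  | C a => exact ⟨0, algebraMap k R a, fun s _ => by simp⟩
  | add P Q hP hQ =>
    obtain ⟨n, r, hr⟩ := hP
    obtain ⟨m, q, hq⟩ := hQ
    refine ⟨n + m, d ^ m * r + d ^ n * q, fun s hs => ?_⟩
    simp only [map_add, map_mul, map_pow, hr s hs, hq s hs]
    ring
  | mul_X P i hP =>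
    obtain ⟨n, r, hr⟩ := hP
    refine ⟨n + 1, r * H i, fun s hs => ?_⟩
    simp only [map_mul, hr s hs, MvPolynomial.eval_X]
    have h := div_mul_cancel₀ (ev s (H i)) hs
    rw [pow_succ]
    linear_combination -(ev s d ^ n *
      MvPolynomial.eval (fun i => ev s (H i) / ev s d) P) * h

variable [TopologicalSpace S] [Fintype I] [DecidableEq I]

/-- In a regular family of linear systems of equations, the parameters for which the system is
degenerate or has a solution satisfying given polynomial equations form a closed set. -/
theorem isClosed_setOf_degenerate_or_solution (ev : S → R →ₐ[k] k)
    (hev : ∀ r, IsOpen {s | ev s r ≠ 0})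
    (M : S → (I → k) →ₗ[k] F) (hM : ∀ i, IsRegularVec ev fun s => M s (Pi.single i 1))
    (b : F) (𝓟 : Set (MvPolynomial I k)) :
    IsClosed {s | ¬ Function.Injective (M s) ∨
      ∃ x, M s x = b ∧ ∀ P ∈ 𝓟, MvPolynomial.eval x P = 0} := by
  rw [← isOpen_compl_iff, isOpen_iff_mem_nhds]
  intro s₀ hs₀
  simp only [Set.mem_compl_iff, Set.mem_ofPred_eq, not_or, not_not] at hs₀
  obtain ⟨hinj, hsol⟩ := hs₀
  -- With `L` fixed, the determinant `d` of `L ∘ M s` is regular in `s` and equals `1` at `s₀`.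
  -- Where it does not vanish, `M s` is injective and the only candidate solution is Cramer's vector
  -- `H / d`.
  obtain ⟨L, hL⟩ := LinearMap.exists_leftInverse_of_injective (M s₀) (LinearMap.ker_eq_bot.mpr hinj)
  choose N hN using fun i j => hM j ((LinearMap.proj i).comp L)
  let Nm : Matrix I I R := Matrix.of N
  have hNm : ∀ s, LinearMap.toMatrix' (L.comp (M s)) = Nm.map (ev s) := by
    intro s
    ext i j
    simp only [LinearMap.toMatrix'_apply, LinearMap.comp_apply, Matrix.map_apply, Nm,
      Matrix.of_apply, ← hN]
    rfl
  let d : R := Nm.det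
  have hd : ∀ s, ev s d = (LinearMap.toMatrix' (L.comp (M s))).det := by
    intro s
    rw [hNm]
    exact (ev s : R →+* k).map_det Nm
  let H : I → R := Nm.adjugate.mulVec fun i => algebraMap k R (L b i)
  have hH : ∀ s, (fun i => ev s (H i)) =
      (LinearMap.toMatrix' (L.comp (M s))).adjugate.mulVec (L b) := by
    intro s
    rw [hNm]
    have := (ev s : R →+* k).map_adjugate Nm
    simp only [RingHom.mapMatrix_apply] at this
    funext i
    change (ev s : R →+* k) (H i) = _
    rw [RingHom.map_mulVec, this]
    congr 1
    funext i
    simp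
  have hsolution : ∀ s, ev s d ≠ 0 → ∀ x, M s x = b → x = fun i => ev s (H i) / ev s d := by
    intro s hs x hx
    have h1 : (LinearMap.toMatrix' (L.comp (M s))).mulVec x = L b := by
      rw [LinearMap.toMatrix'_mulVec, LinearMap.comp_apply, hx]
    have h2 : (fun i => ev s (H i)) = ev s d • x := by
      rw [hH, ← h1, Matrix.mulVec_mulVec, Matrix.adjugate_mul, hd, Matrix.smul_mulVec,
        Matrix.one_mulVec]
    funext i
    rw [eq_div_iff hs, congrFun h2 i, Pi.smul_apply, smul_eq_mul, mul_comm]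
  have hinj' : ∀ s, ev s d ≠ 0 → Function.Injective (M s) := by
    intro s hs
    rw [← LinearMap.ker_eq_bot, LinearMap.ker_eq_bot']
    intro x hx
    have h1 : (LinearMap.toMatrix' (L.comp (M s))).mulVec x = 0 := by
      rw [LinearMap.toMatrix'_mulVec, LinearMap.comp_apply, hx, map_zero]
    exact Matrix.eq_zero_of_mulVec_eq_zero (by rwa [← hd]) h1
  have hd₀ : ev s₀ d = 1 := by rw [hd, hL, LinearMap.toMatrix'_id, Matrix.det_one]
  have hdnhds : {s | ev s d ≠ 0} ∈ nhds s₀ := (hev d).mem_nhds (by simp [hd₀])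
  set x₀ : I → k := fun i => ev s₀ (H i) / ev s₀ d with hx₀
  -- At `s₀` the candidate either violates an equation of `𝓟` or fails to solve the system. Either
  -- failure is the nonvanishing of one element of `R`, hence persists nearby.
  by_cases hMx : M s₀ x₀ = b
  · obtain ⟨P, hP, hPx⟩ : ∃ P ∈ 𝓟, MvPolynomial.eval x₀ P ≠ 0 := by
      by_contra! h
      exact hsol ⟨x₀, hMx, h⟩
    obtain ⟨n, r, hr⟩ := exists_clear_denominators ev d H P
    have hr₀ : ev s₀ r ≠ 0 := by
      rw [hr s₀ (by simp [hd₀])]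
      exact mul_ne_zero (by simp [hd₀]) hPx
    filter_upwards [hdnhds, (hev r).mem_nhds hr₀] with s hs hsr
    simp only [Set.mem_compl_iff, Set.mem_ofPred_eq, not_or, not_not]
    refine ⟨hinj' s hs, ?_⟩
    rintro ⟨x, hx, hxP⟩
    apply hsr
    rw [hr s hs, ← hsolution s hs x hx, hxP P hP, mul_zero]
  · obtain ⟨l, hl⟩ : ∃ l : Module.Dual k F, l (M s₀ x₀ - b) ≠ 0 := by
      by_contra! h
      exact hMx (sub_eq_zero.mp ((Module.forall_dual_apply_eq_zero_iff k _).mp h))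
    choose c hc using fun i => hM i l
    let r : R := ∑ i, H i * c i - d * algebraMap k R (l b)
    have hr : ∀ s, ev s d ≠ 0 → ev s r =
        ev s d * l (M s (fun i => ev s (H i) / ev s d) - b) := by
      intro s hs
      have h1 : M s (fun i => ev s (H i) / ev s d) =
          ∑ i, (ev s (H i) / ev s d) • M s (Pi.single i 1) := by
        conv_lhs => rw [pi_eq_sum_univ' (fun i => ev s (H i) / ev s d)]
        simp [map_sum]
      rw [h1]
      simp only [map_sub, map_sum, map_smul, hc, smul_eq_mul, r, map_mul, AlgHom.commutes]
      rw [mul_sub, Finset.mul_sum]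
      congr 1
      exact Finset.sum_congr rfl fun i _ => by field_simp
    have hr₀ : ev s₀ r ≠ 0 := by
      rw [hr s₀ (by simp [hd₀])]
      exact mul_ne_zero (by simp [hd₀]) hl
    filter_upwards [hdnhds, (hev r).mem_nhds hr₀] with s hs hsr
    simp only [Set.mem_compl_iff, Set.mem_ofPred_eq, not_or, not_not]
    refine ⟨hinj' s hs, ?_⟩
    rintro ⟨x, hx, -⟩
    apply hsr
    rw [hr s hs, ← hsolution s hs x hx, hx, sub_self, map_zero, mul_zero]

end Linear

/-! ### Rational points and Chevalley's theorem -/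

section Chevalley

variable {k A B R I : Type*} [Field k] [CommRing A] [Algebra k A] [CommRing B] [Algebra k B]
  [CommRing R] [Algebra k R]

/-- The `k`-rational point of `Spec A` given by a homomorphism of `k`-algebras `A → k`. -/
def ratPoint (g : A →ₐ[k] k) : PrimeSpectrum A :=
  PrimeSpectrum.comap (g : A →+* k) ⊥

@[simp]
theorem mem_ratPoint {g : A →ₐ[k] k} {a : A} : a ∈ (ratPoint g).asIdeal ↔ g a = 0 :=
  Iff.rfl

theorem comap_ratPoint (f : B →ₐ[k] A) (g : A →ₐ[k] k) :
    PrimeSpectrum.comap (f : B →+* A) (ratPoint g) = ratPoint (g.comp f) :=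
  rfl

theorem ratPoint_injective : Function.Injective (ratPoint : (A →ₐ[k] k) → PrimeSpectrum A) := by
  intro g h hgh
  ext a
  have : a - algebraMap k A (g a) ∈ (ratPoint g).asIdeal := by simp
  rw [hgh, mem_ratPoint] at this
  simpa [sub_eq_zero, eq_comm (a := h a)] using this

theorem exists_ratPoint_eq [IsAlgClosed k] [Algebra.FiniteType k A] {x : PrimeSpectrum A}
    (hx : x.asIdeal.IsMaximal) : ∃ g : A →ₐ[k] k, ratPoint g = x := by
  let _ := Ideal.Quotient.field x.asIdeal
  have := finite_of_finite_type_of_isJacobsonRing k (A ⧸ x.asIdeal)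
  have hbij : Function.Bijective (algebraMap k (A ⧸ x.asIdeal)) :=
    IsAlgClosed.algebraMap_bijective_of_isIntegral
  let φ : k ≃ₐ[k] (A ⧸ x.asIdeal) := AlgEquiv.ofBijective (Algebra.ofId k _) hbij
  refine ⟨(φ.symm : _ →ₐ[k] k).comp (Ideal.Quotient.mkₐ k x.asIdeal), ?_⟩
  ext a
  simp [Ideal.Quotient.eq_zero_iff_mem]

/-- `A` is a Jacobson ring, so a nonempty locally closed piece of `E` contains a closed point, which
is rational by the Nullstellensatz. -/
theorem exists_ratPoint_mem [IsAlgClosed k] [Algebra.FiniteType k A] {E : Set (PrimeSpectrum A)}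
    (hE : Topology.IsConstructible E) (hne : E.Nonempty) : ∃ g : A →ₐ[k] k, ratPoint g ∈ E := by
  have : IsJacobsonRing A := isJacobsonRing_of_finiteType (A := k)
  obtain ⟨D, rfl⟩ := PrimeSpectrum.exists_constructibleSetData_iff.mpr hE
  obtain ⟨x, hx⟩ := hne
  obtain ⟨C, hC, hxC⟩ := Set.mem_iUnion₂.mp hx
  have hlc : IsLocallyClosed C.toSet :=
    (PrimeSpectrum.isClosed_zeroLocus _).isLocallyClosed.inter
      (PrimeSpectrum.isClosed_zeroLocus _).isOpen_compl.isLocallyClosed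
  obtain ⟨y, hyC, hy⟩ := nonempty_inter_closedPoints ⟨x, hxC⟩ hlc
  obtain ⟨g, rfl⟩ := exists_ratPoint_eq (k := k)
    ((PrimeSpectrum.isClosed_singleton_iff_isMaximal y).mp hy)
  exact ⟨g, Set.mem_iUnion₂.mpr ⟨C, hC, hyC⟩⟩

/-- Chevalley's theorem for the projection of a constructible subset of `Spec R × 𝔸ⁿ` to `𝔸ⁿ`, on
`k`-rational points. -/
theorem exists_isConstructible_forall_mem_iff [IsAlgClosed k] [Algebra.FiniteType k R] [Finite I]
    {E : Set (PrimeSpectrum (MvPolynomial I R))} (hE : Topology.IsConstructible E) :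
    ∃ Q : Set (PrimeSpectrum (MvPolynomial I k)), Topology.IsConstructible Q ∧ ∀ x : I → k,
      ratPoint (MvPolynomial.aeval x) ∈ Q ↔
        ∃ e : R →ₐ[k] k, ratPoint (MvPolynomial.aevalTower e x) ∈ E := by
  let f : MvPolynomial I k →ₐ[k] MvPolynomial I R := MvPolynomial.mapAlgHom (Algebra.ofId k R)
  have hcomp : ∀ (e : R →ₐ[k] k) (x : I → k),
      (MvPolynomial.aevalTower e x).comp f = MvPolynomial.aeval x := by
    intro e x
    ext i
    simp [f]
  have hft : Algebra.FiniteType k (MvPolynomial I R) :=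
    Algebra.FiniteType.trans (S := R) inferInstance inferInstance
  have hf : (f : MvPolynomial I k →+* MvPolynomial I R).FinitePresentation := by
    rw [← RingHom.FinitePresentation.of_finiteType]
    refine RingHom.FiniteType.of_comp_finiteType (f := algebraMap k (MvPolynomial I k)) ?_
    rw [f.comp_algebraMap]
    exact RingHom.finiteType_algebraMap.mpr hft
  refine ⟨_, PrimeSpectrum.isConstructible_comap_image hf hE, fun x => ⟨?_, ?_⟩⟩
  · rintro ⟨z, hz, hzx⟩
    have hclosed : IsClosed {(ratPoint (MvPolynomial.aeval x) : PrimeSpectrum (MvPolynomial I k))} :=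
      by
      rw [PrimeSpectrum.isClosed_singleton_iff_isMaximal]
      exact RingHom.ker_isMaximal_of_surjective (MvPolynomial.aeval x : MvPolynomial I k →ₐ[k] k)
        fun a => ⟨MvPolynomial.C a, by simp⟩
    -- The point `z` over `x` need not be rational; the part of `E` over the closed point `x` is
    -- constructible and nonempty, so it also contains a rational point.
    have hE' : Topology.IsConstructible
        (E ∩ PrimeSpectrum.comap (f : MvPolynomial I k →+* MvPolynomial I R) ⁻¹'
          {ratPoint (MvPolynomial.aeval x)}) := by
      have : IsNoetherianRing (MvPolynomial I R) := Algebra.FiniteType.isNoetherianRing k _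
      refine hE.inter (IsConstructibleSet.isConstructible ?_)
      exact (hclosed.preimage (PrimeSpectrum.continuous_comap _)).isLocallyClosed.isConstructibleSet
    obtain ⟨g, hgE, hg⟩ := exists_ratPoint_mem (k := k) hE' ⟨z, hz, hzx⟩
    let e : R →ₐ[k] k := g.comp (IsScalarTower.toAlgHom k R (MvPolynomial I R))
    have hgf : g.comp f = MvPolynomial.aeval x := ratPoint_injective hg
    have hge : g = MvPolynomial.aevalTower e x := by
      ext i
      · simp [e, MvPolynomial.algebraMap_eq]
      · have := congr($hgf (MvPolynomial.X i))
        simpa [f] using this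
    exact ⟨e, hge ▸ hgE⟩
  · rintro ⟨e, he⟩
    exact ⟨_, he, by rw [comap_ratPoint, hcomp]⟩

end Chevalley

open scoped TensorProduct

/-! ### Regular vector-valued functions -/

section Regular

variable {k S R F G ι : Type*} [Field k] [CommRing R] [Algebra k R]
  [AddCommGroup F] [Module k F] [AddCommGroup G] [Module k G] {ev : S → R →ₐ[k] k}

theorem IsRegularVec.const (w : F) : IsRegularVec ev fun _ => w :=
  fun l => ⟨algebraMap k R (l w), fun s => by simp⟩

theorem IsRegularVec.add {v w : S → F} (hv : IsRegularVec ev v) (hw : IsRegularVec ev w) :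
    IsRegularVec ev fun s => v s + w s := by
  intro l
  obtain ⟨r, hr⟩ := hv l
  obtain ⟨q, hq⟩ := hw l
  exact ⟨r + q, fun s => by simp [hr, hq]⟩

theorem IsRegularVec.map {v : S → F} (hv : IsRegularVec ev v) (L : F →ₗ[k] G) :
    IsRegularVec ev fun s => L (v s) :=
  fun l => hv (l.comp L)

theorem IsRegularVec.pi [Fintype ι] [DecidableEq ι] {v : S → ι → F}
    (hv : ∀ i, IsRegularVec ev fun s => v s i) : IsRegularVec ev v := by
  intro l
  choose r hr using fun i => hv i (l.comp (LinearMap.single k (fun _ => F) i))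
  refine ⟨∑ i, r i, fun s => ?_⟩
  conv_lhs => rw [← Finset.univ_sum_single (v s)]
  rw [map_sum, map_sum]
  exact Finset.sum_congr rfl fun i _ => hr i s

end Regular

/-! ### The linear system attached to a tuple of elements of `K` -/

section System

variable {k K ι α : Type*} [Field k] [CommRing K] [Algebra k K]

/-- The linear combination of the vectors `v` whose coefficients are the `o`-th block of `x`. -/
def blockComb [Fintype α] (v : α → K) (o : Option ι) : (Option ι × α → k) →ₗ[k] K :=
  ∑ a, (LinearMap.toSpanSingleton k K (v a)).comp (LinearMap.proj (o, a))

theorem blockComb_apply [Fintype α] (v : α → K) (o : Option ι) (x : Option ι × α → k) :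
    blockComb v o x = ∑ a, x (o, a) • v a := by
  simp [blockComb]

/-- The bilinear map whose zeros are the tuples of `K` proportional to a given tuple. -/
def proportionality [Fintype α] (v : α → K) :
    (Option ι → K) →ₗ[k] (Option ι × α → k) →ₗ[k] (ι → K) :=
  LinearMap.mk₂ k
    (fun q x i => blockComb v (some i) x * q none - blockComb v none x * q (some i))
    (fun q q' x => by ext i; simp only [Pi.add_apply]; ring)
    (fun c q x => by ext i; simp [smul_sub])
    (fun q x x' => by ext i; simp only [map_add, Pi.add_apply]; ring)
    (fun c q x => by ext i; simp [smul_sub])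

theorem proportionality_apply [Fintype α] (v : α → K) (q : Option ι → K) (x : Option ι × α → k)
    (i : ι) : proportionality v q x i =
      blockComb v (some i) x * q none - blockComb v none x * q (some i) :=
  rfl

theorem proportionality_smul [Fintype α] (v : α → K) (c : K) (q : Option ι → K)
    (x : Option ι × α → k) : proportionality v (c • q) x = c • proportionality v q x := by
  ext i
  simp only [proportionality_apply, Pi.smul_apply, smul_eq_mul]
  ring

/-- The equations expressing that the tuple of `K` with coordinates `x` is proportional to `q`,
together with the values of the coordinates of `x` belonging to `J`. -/
noncomputable def system [Fintype α] [DecidableEq ι] [DecidableEq α] (v : α → K) (q : Option ι → K)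
    (J : Finset (Option ι × α)) :
    (Option ι × α → k) →ₗ[k] (ι → K) × (Option ι × α → k) :=
  (proportionality v q).prod (LinearMap.pi fun c => if c ∈ J then LinearMap.proj c else 0)

variable [Fintype α] [DecidableEq ι] [DecidableEq α]

theorem system_apply_eq_iff (v : α → K) (q : Option ι → K) (J : Finset (Option ι × α))
    (x z : Option ι × α → k) : system v q J x = (0, z) ↔
      proportionality v q x = 0 ∧ ∀ c, (if c ∈ J then x c else 0) = z c := by
  change (proportionality v q x, fun c => (if c ∈ J then LinearMap.proj c else 0 :
    (Option ι × α → k) →ₗ[k] k) x) = (0, z) ↔ _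
  rw [Prod.mk.injEq, funext_iff (g := z)]
  refine and_congr_right fun _ => forall_congr' fun c => ?_
  split_ifs <;> rfl

/-- This allows `(1, y)` to be replaced by a multiple without denominators, which is regular in
families. -/
theorem system_smul_apply_eq_iff [IsDomain K] (v : α → K) {c : K} (hc : c ≠ 0) (q : Option ι → K)
    (J : Finset (Option ι × α)) (x z : Option ι × α → k) :
    system v (c • q) J x = (0, z) ↔ system v q J x = (0, z) := by
  rw [system_apply_eq_iff, system_apply_eq_iff, proportionality_smul, smul_eq_zero_iff_right hc]

theorem injective_system_iff (v : α → K) (q : Option ι → K) (J : Finset (Option ι × α)) :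
    Function.Injective (system (k := k) v q J) ↔ ∀ x, system (k := k) v q J x = (0, 0) → x = 0 := by
  rw [← LinearMap.ker_eq_bot, LinearMap.ker_eq_bot']
  rfl

theorem injective_system_smul_iff [IsDomain K] (v : α → K) {c : K} (hc : c ≠ 0) (q : Option ι → K)
    (J : Finset (Option ι × α)) :
    Function.Injective (system (k := k) v (c • q) J) ↔
      Function.Injective (system (k := k) v q J) := by
  simp only [injective_system_iff, system_smul_apply_eq_iff v hc]

/-- If `q` is proportional to some nonzero tuple of coordinates, then such a tuple becomes unique
after normalizing suitable coordinates. -/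
theorem exists_injective_system [Finite ι] (v : α → K) (q : Option ι → K)
    (x : Option ι × α → k) (hx : x ≠ 0) (hqx : proportionality v q x = 0) :
    ∃ J c, Function.Injective (system (k := k) v q J) ∧
      ∃ z, system (k := k) v q J z = (0, Pi.single c 1) := by
  classical
  have := Fintype.ofFinite ι
  -- For `J` maximal in `𝒥`, with nonzero solution `z` vanishing on `J` and `z c ≠ 0`, no nonzero
  -- solution vanishes on `insert c J`. Rescaling `z` gives the normalized solution.
  let 𝒥 : Finset (Finset (Option ι × α)) := Finset.univ.filter fun J =>
    ∃ x : Option ι × α → k, x ≠ 0 ∧ proportionality v q x = 0 ∧ ∀ c ∈ J, x c = 0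
  have hne : 𝒥.Nonempty := ⟨∅, by simpa [𝒥] using ⟨x, hx, hqx⟩⟩
  obtain ⟨J, hJ⟩ := 𝒥.exists_maximal hne
  obtain ⟨z, hz, hqz, hzJ⟩ := (Finset.mem_filter.mp hJ.prop).2
  obtain ⟨c, hc⟩ := Function.ne_iff.mp hz
  refine ⟨insert c J, c, ?_, (z c)⁻¹ • z, ?_⟩
  · rw [injective_system_iff]
    intro w hw
    rw [system_apply_eq_iff] at hw
    by_contra hw0
    have hmem : insert c J ∈ 𝒥 := by
      refine Finset.mem_filter.mpr ⟨Finset.mem_univ _, w, hw0, hw.1, fun d hd => ?_⟩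
      simpa [hd] using hw.2 d
    have := hJ.le_of_ge hmem (Finset.subset_insert c J) (Finset.mem_insert_self c J)
    exact hc (hzJ c this)
  · rw [system_apply_eq_iff, map_smul, hqz, smul_zero]
    refine ⟨rfl, fun d => ?_⟩
    by_cases hd : d = c
    · subst hd
      simpa using inv_mul_cancel₀ hc
    · by_cases hdJ : d ∈ J
      · simp [hd, hdJ, hzJ]
      · simp [hd, hdJ]

end System

/-! ### Constructibility of the image of a chart -/

section Chart

variable {k B K ι : Type u} [Field k] [CommRing B] [Algebra k B] [CommRing K] [Algebra k K]
  [Algebra B K] [IsScalarTower k B K]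

variable (B K) in
/-- The evaluation of the functions on `Spec R × Spec B` on the fibre over a `k`-rational point of
`Spec R`, with values in an extension `K` of `B`. -/
noncomputable def evalFibre {R : Type*} [CommRing R] [Algebra k R] (e : R →ₐ[k] k) :
    R ⊗[k] B →ₐ[k] K :=
  Algebra.TensorProduct.lift ((Algebra.ofId k K).comp e) (IsScalarTower.toAlgHom k B K)
    fun _ _ => .all _ _

theorem evalFibre_tmul {R : Type*} [CommRing R] [Algebra k R] (e : R →ₐ[k] k) (r : R) (b : B) :
    evalFibre B K e (r ⊗ₜ b) = e r • algebraMap B K b := by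
  simp [evalFibre, Algebra.smul_def, Algebra.ofId_apply]

theorem isRegularVec_evalFibre {S R : Type*} [CommRing R] [Algebra k R] (ev : S → R →ₐ[k] k)
    (q : R ⊗[k] B) : IsRegularVec ev fun s => evalFibre B K (ev s) q := by
  intro l
  induction q with
  | zero => exact ⟨0, by simp⟩
  | tmul r b => exact ⟨r * algebraMap k R (l (algebraMap B K b)), by simp [evalFibre_tmul]⟩
  | add p q hp hq =>
    obtain ⟨r, hr⟩ := hp
    obtain ⟨r', hr'⟩ := hq
    exact ⟨r + r', fun s => by simp [hr, hr']⟩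

/-- A family of elements of `Y`, parametrized by some of the `k`-rational points of `Spec R`, whose
coordinates `y` are quotients of elements of `R ⊗ B`. -/
structure IsChart {Y S R : Type*} [TopologicalSpace S] [CommRing R] [Algebra k R]
    (y : Y → ι → K) (ev : S → R →ₐ[k] k) (p : Option ι → R ⊗[k] B) (ψ : S → Y) : Prop where
  isOpen : ∀ r, IsOpen {s | ev s r ≠ 0}
  ne_zero : ∀ s, evalFibre B K (ev s) (p none) ≠ 0
  eq_mul : ∀ s i, evalFibre B K (ev s) (p (some i)) = evalFibre B K (ev s) (p none) * y (ψ s) i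

/-- The tuple `(1, y₁, …, yₙ)`. -/
def homogenize (y : ι → K) : Option ι → K := fun o => o.elim 1 y

variable {Y : Type u} [TopologicalSpace Y] {y : Y → ι → K}

/-- The elements of `Y` for which the system is degenerate or has a solution lying in the algebraic
set defined by `𝓟`. -/
def solutionLocus {α : Type*} [Fintype α] [DecidableEq ι] [DecidableEq α] (y : Y → ι → K)
    (v : α → K) (J : Finset (Option ι × α)) (c : Option ι × α)
    (𝓟 : Set (MvPolynomial (Option ι × α) k)) : Set Y :=
  {ψ | ¬ Function.Injective (system (k := k) v (homogenize (y ψ)) J) ∨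
    ∃ x, system (k := k) v (homogenize (y ψ)) J x = (0, Pi.single c 1) ∧
      ∀ P ∈ 𝓟, MvPolynomial.eval x P = 0}

/-- On a chart, `p` evaluates to a nonzero multiple of `(1, y)`. The system built from `p` is
therefore equivalent and has regular coefficients, so the closedness result for linear families
applies. -/
theorem isClosed_solutionLocus [IsDomain K] [Finite ι] [DecidableEq ι]
    (hcl : ∀ F : Set Y, (∀ (S R : Type u) [TopologicalSpace S] [CommRing R] [Algebra k R]
      (ev : S → R →ₐ[k] k) (p : Option ι → R ⊗[k] B) (ψ : S → Y), IsChart y ev p ψ →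
        IsClosed (ψ ⁻¹' F)) → IsClosed F)
    {α : Type*} [Fintype α] [DecidableEq α] (v : α → K) (J : Finset (Option ι × α))
    (c : Option ι × α) (𝓟 : Set (MvPolynomial (Option ι × α) k)) :
    IsClosed (solutionLocus y v J c 𝓟) := by
  have := Fintype.ofFinite ι
  refine hcl _ fun S R _ _ _ ev p ψ h => ?_
  let q : S → Option ι → K := fun s o => evalFibre B K (ev s) (p o)
  have hq : ∀ s, q s = q s none • homogenize (y (ψ s)) := by
    intro s
    funext o
    cases o with
    | none => simp [homogenize]
    | some i => exact h.eq_mul s i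
  have hreg : IsRegularVec ev q := .pi fun o => isRegularVec_evalFibre ev (p o)
  convert isClosed_setOf_degenerate_or_solution ev h.isOpen
    (fun s => system (k := k) v (q s) J) (fun c => ?_) (0, Pi.single c 1) 𝓟 using 1
  · ext s
    simp only [solutionLocus, Set.mem_preimage, Set.mem_ofPred_eq]
    rw [hq s]
    have h0 : q s none ≠ 0 := h.ne_zero s
    simp only [injective_system_smul_iff v h0, system_smul_apply_eq_iff v h0]
  · have h1 := (hreg.map ((proportionality (k := k) v).flip (Pi.single c 1))).map
      (LinearMap.inl k (ι → K) (Option ι × α → k))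
    have h2 := h1.add (IsRegularVec.const (ev := ev)
      (LinearMap.inr k (ι → K) (Option ι × α → k)
        ((LinearMap.pi fun c => if c ∈ J then LinearMap.proj c else 0 :
          (Option ι × α → k) →ₗ[k] (Option ι × α → k)) (Pi.single c 1))))
    convert h2 using 2 with s
    simp [system]

/-- A `k`-basis of `B` is also an `R`-basis of `R ⊗ B`. Finitely many of its vectors occur in the `p
i`, and they stay independent in `K` since `B` embeds there. -/
theorem exists_linearIndependent_evalFibre_eq [FaithfulSMul B K] [Finite ι] {R : Type*} [CommRing R]
    [Algebra k R] (p : ι → R ⊗[k] B) :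
    ∃ (α : Type u) (_ : Fintype α) (v : α → K) (c : ι → α → R), LinearIndependent k v ∧
      ∀ (e : R →ₐ[k] k) (i : ι), evalFibre B K e (p i) = ∑ a, e (c i a) • v a := by
  classical
  have := Fintype.ofFinite ι
  let bas := Module.Basis.ofVectorSpace k B
  let m := bas.baseChange R
  let s := Finset.univ.biUnion fun i => (m.repr (p i)).support
  refine ⟨s, inferInstance, fun a => algebraMap B K (bas a), fun i a => m.repr (p i) a, ?_, ?_⟩
  · have h1 : LinearIndependent k fun a : s => bas a :=
      bas.linearIndependent.comp _ Subtype.val_injective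
    exact h1.map' (IsScalarTower.toAlgHom k B K).toLinearMap
      (LinearMap.ker_eq_bot.mpr (FaithfulSMul.algebraMap_injective B K))
  · intro e i
    have hp : p i = ∑ a : s, m.repr (p i) a • m a := by
      conv_lhs => rw [← m.linearCombination_repr (p i), Finsupp.linearCombination_apply]
      rw [Finsupp.sum_of_support_subset (s := s) _
        (Finset.subset_biUnion_of_mem (fun i => (m.repr (p i)).support) (Finset.mem_univ i)) _
        (by simp)]
      exact (Finset.sum_coe_sort s fun a => m.repr (p i) a • m a).symm
    conv_lhs => rw [hp]
    rw [map_sum]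
    refine Finset.sum_congr rfl fun a _ => ?_
    rw [Module.Basis.baseChange_apply, TensorProduct.smul_tmul', smul_eq_mul, mul_one,
      evalFibre_tmul]

/-- The elements of `Y` occurring in a chart with a constructible parameter set form a constructible
set. -/
theorem isConstructibleSet_of_chart [IsDomain K] [IsAlgClosed k] [FaithfulSMul B K] [Finite ι]
    (hcl : ∀ F : Set Y, (∀ (S R : Type u) [TopologicalSpace S] [CommRing R] [Algebra k R]
      (ev : S → R →ₐ[k] k) (p : Option ι → R ⊗[k] B) (ψ : S → Y), IsChart y ev p ψ →
        IsClosed (ψ ⁻¹' F)) → IsClosed F)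
    {R : Type u} [CommRing R] [Algebra k R] [Algebra.FiniteType k R] (p : Option ι → R ⊗[k] B)
    {C : Set (PrimeSpectrum R)} (hC : IsConstructibleSet C)
    (hpC : ∀ e : R →ₐ[k] k, ratPoint e ∈ C → evalFibre B K e (p none) ≠ 0) :
    IsConstructibleSet {ψ : Y | ∃ e : R →ₐ[k] k, ratPoint e ∈ C ∧
      ∀ i, evalFibre B K e (p (some i)) = evalFibre B K e (p none) * y ψ i} := by
  classical
  have := Fintype.ofFinite ι
  obtain ⟨α, _, v, r, hv, hr⟩ := exists_linearIndependent_evalFibre_eq (K := K) p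
  let I := Option ι × α
  -- Testing the proportionality relations in `K` against all linear functionals turns them into
  -- polynomial equations in `x` over `R`.
  let G : ι × Module.Dual k K → MvPolynomial I R := fun il => ∑ a, ∑ b,
    MvPolynomial.C (algebraMap k R (il.2 (v a * v b))) *
      (MvPolynomial.X (some il.1, a) * MvPolynomial.C (r none b) -
        MvPolynomial.X (none, a) * MvPolynomial.C (r (some il.1) b))
  have hG : ∀ (e : R →ₐ[k] k) (x : I → k) il, MvPolynomial.aevalTower e x (G il) =
      il.2 (proportionality v (fun o => evalFibre B K e (p o)) x il.1) := by
    rintro e x ⟨i, l⟩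
    simp only [G, map_sum, map_mul, map_sub, MvPolynomial.aevalTower_C, MvPolynomial.aevalTower_X,
      AlgHom.commutes, proportionality_apply, blockComb_apply, hr, Finset.sum_mul_sum,
      smul_mul_smul_comm, map_smul, smul_eq_mul, ← Finset.sum_sub_distrib]
    refine Finset.sum_congr rfl fun a _ => Finset.sum_congr rfl fun b _ => ?_
    simp only [Algebra.algebraMap_self, RingHom.id_apply]
    ring
  have hnoeth : IsNoetherianRing R := Algebra.FiniteType.isNoetherianRing k R
  let E : Set (PrimeSpectrum (MvPolynomial I R)) :=
    PrimeSpectrum.comap MvPolynomial.C ⁻¹' C ∩ PrimeSpectrum.zeroLocus (Set.range G)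
  have hE : Topology.IsConstructible E :=
    (hC.preimage (PrimeSpectrum.continuous_comap _)).isConstructible.inter
      (PrimeSpectrum.isClosed_zeroLocus _).isLocallyClosed.isConstructibleSet.isConstructible
  have hEiff : ∀ (e : R →ₐ[k] k) (x : I → k), ratPoint (MvPolynomial.aevalTower e x) ∈ E ↔
      ratPoint e ∈ C ∧ proportionality v (fun o => evalFibre B K e (p o)) x = 0 := by
    intro e x
    refine and_congr ?_ ?_
    · have : PrimeSpectrum.comap MvPolynomial.C (ratPoint (MvPolynomial.aevalTower e x)) =
          ratPoint e := by
        ext a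
        simp
      rw [Set.mem_preimage, this]
    · simp only [PrimeSpectrum.mem_zeroLocus, Set.range_subset_iff, SetLike.mem_coe, mem_ratPoint,
        hG, Prod.forall]
      rw [funext_iff]
      exact forall_congr' fun i => Module.forall_dual_apply_eq_zero_iff k _
  obtain ⟨Q, hQ, hQE⟩ := exists_isConstructible_forall_mem_iff (k := k) hE
  -- A normalized solution `x` determines `y ψ` as quotients of its blocks, so `x ∈ Q` is a
  -- condition on `ψ` alone.
  have hmem : ∀ (ψ : Y) (J : Finset I) (c : I) (x : I → k),
      system v (homogenize (y ψ)) J x = (0, Pi.single c 1) →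
      (ratPoint (MvPolynomial.aeval x) ∈ Q ↔ ∃ e : R →ₐ[k] k, ratPoint e ∈ C ∧
        ∀ i, evalFibre B K e (p (some i)) = evalFibre B K e (p none) * y ψ i) := by
    intro ψ J c x hx
    obtain ⟨hx₁, hx₂⟩ := (system_apply_eq_iff v _ J x _).mp hx
    have hxi : ∀ i, blockComb v (some i) x = blockComb v none x * y ψ i := by
      intro i
      have := congrFun hx₁ i
      rw [proportionality_apply] at this
      simpa [homogenize, sub_eq_zero] using this
    -- If the denominator vanished, so would every block; independence of `v` would then force `x c
    -- = 0`, whereas the normalization says `x c = 1`.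
    have hx0 : blockComb v none x ≠ 0 := by
      intro h0
      have hz : ∀ o, blockComb v o x = 0 := by
        rintro (_ | i)
        · exact h0
        · rw [hxi, h0, zero_mul]
      have hxc := hx₂ c
      have : x c = 0 := by
        have := hz c.1
        rw [blockComb_apply] at this
        exact Fintype.linearIndependent_iff.mp hv (fun a => x (c.1, a)) this c.2
      simp [this] at hxc
    rw [hQE]
    refine exists_congr fun e => ?_
    rw [hEiff]
    refine and_congr_right fun _ => ?_
    rw [funext_iff]
    refine forall_congr' fun i => ?_
    rw [proportionality_apply, hxi, Pi.zero_apply, sub_eq_zero, mul_assoc,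
      mul_right_inj' hx0, eq_comm, mul_comm (y ψ i)]
  obtain ⟨D, rfl⟩ := PrimeSpectrum.exists_constructibleSetData_iff.mpr hQ
  -- For a piece `g = 0`, `f ≠ 0` of `Q`, both loci contain the degenerate `ψ`. Their difference
  -- consists of the `ψ` whose unique normalized solution satisfies `g = 0` and `f ≠ 0`.
  have hunion : {ψ : Y | ∃ e : R →ₐ[k] k, ratPoint e ∈ C ∧
      ∀ i, evalFibre B K e (p (some i)) = evalFibre B K e (p none) * y ψ i} =
      ⋃ t : (Finset I × I) × D, solutionLocus y v t.1.1 t.1.2 (Set.range t.2.1.g) \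
        solutionLocus y v t.1.1 t.1.2 {t.2.1.f} := by
    ext ψ
    simp only [Set.mem_iUnion, Set.mem_ofPred_eq]
    constructor
    · rintro ⟨e, heC, he⟩
      obtain ⟨J, c, hinj, x, hx⟩ := exists_injective_system (k := k) v (homogenize (y ψ))
        (fun oa => e (r oa.1 oa.2)) (by
          intro h0
          apply hpC e heC
          rw [hr]
          refine Finset.sum_eq_zero fun a _ => ?_
          rw [congrFun h0 (none, a), Pi.zero_apply, zero_smul]) (by
          ext i
          rw [proportionality_apply, blockComb_apply, blockComb_apply, ← hr, ← hr, he]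
          simp [homogenize])
      have hxQ := (hmem ψ J c x hx).mpr ⟨e, heC, he⟩
      obtain ⟨A, hA, hxg, hxf⟩ := Set.mem_iUnion₂.mp hxQ
      refine ⟨((J, c), ⟨A, hA⟩), Or.inr ⟨x, hx, fun P hP => hxg hP⟩, ?_⟩
      rintro (h | ⟨z, hz, hzf⟩)
      · exact h hinj
      · obtain rfl : z = x := hinj (hz.trans hx.symm)
        exact hxf (by simpa [PrimeSpectrum.mem_zeroLocus, MvPolynomial.aeval_eq_eval] using! hzf)
    · rintro ⟨⟨⟨J, c⟩, A, hA⟩, h1, h2⟩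
      obtain ⟨hinj, hf⟩ := not_or.mp h2
      obtain ⟨x, hx, hxg⟩ := h1.resolve_left fun h => h (not_not.mp hinj)
      refine (hmem ψ J c x hx).mp (Set.mem_iUnion₂.mpr ⟨A, hA, fun P hP => hxg P hP, fun h => ?_⟩)
      exact hf ⟨x, hx, fun P hP => h hP⟩
  rw [hunion]
  exact .iUnion fun t => ((isClosed_solutionLocus hcl v _ _ _).isLocallyClosed.inter
    (isClosed_solutionLocus hcl v _ _ _).isOpen_compl.isLocallyClosed).isConstructibleSet

end Chart

/-! ### Coordinates of birational maps and of families -/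

section Scheme

variable {k : Type u} [Field k] {T X : Scheme.{u}} {sT : T ⟶ Spec (.of k)} {sX : X ⟶ Spec (.of k)}

variable {R : Type u} [CommRing R] [Algebra k R] (i : Spec (.of R) ⟶ T)

/-- The point of `T` given by a `k`-rational point of an affine scheme over `T`. -/
noncomputable def pointOfAlgHom (hi : i ≫ sT = Spec.map (CommRingCat.ofHom (algebraMap k R)))
    (e : R →ₐ[k] k) : Points sT :=
  ⟨Spec.map (CommRingCat.ofHom (e : R →+* k)) ≫ i, by
    rw [Category.assoc, hi, ← Spec.map_comp, ← CommRingCat.ofHom_comp, e.comp_algebraMap]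
    exact Spec.map_id _⟩

variable {B : Type u} [CommRing B] (j : Spec (.of B) ⟶ X)

theorem tensor_comm [Algebra k B] (hj : j ≫ sX = Spec.map (CommRingCat.ofHom (algebraMap k B)))
    (hi : i ≫ sT = Spec.map (CommRingCat.ofHom (algebraMap k R))) :
    (Spec.map (CommRingCat.ofHom
      (Algebra.TensorProduct.includeLeft : R →ₐ[k] R ⊗[k] B).toRingHom) ≫ i) ≫ sT =
    (Spec.map (CommRingCat.ofHom
      (Algebra.TensorProduct.includeRight : B →ₐ[k] R ⊗[k] B).toRingHom) ≫ j) ≫ sX := by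
  rw [Category.assoc, Category.assoc, hi, hj, ← Spec.map_comp, ← Spec.map_comp,
    ← CommRingCat.ofHom_comp, ← CommRingCat.ofHom_comp]
  congr 2
  ext c
  simp

/-- The morphism from the product of two affine schemes over `T` and `X` to `T × X`. -/
noncomputable def tensorToProd [Algebra k B] (hj : j ≫ sX = Spec.map (CommRingCat.ofHom (algebraMap k B)))
    (hi : i ≫ sT = Spec.map (CommRingCat.ofHom (algebraMap k R))) :
    Spec (.of (R ⊗[k] B)) ⟶ pullback sT sX :=
  pullback.lift _ _ (tensor_comm i j hj hi)

/-- Geometrically, `evalFibre` at `e` is the generic point of the fibre over `e`, seen as a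
`K`-valued point of the product. -/
theorem map_evalFibre_comp_tensorToProd [IrreducibleSpace X] [Algebra k B]
    [Algebra k X.functionField] [Algebra B X.functionField] [IsScalarTower k B X.functionField]
    (hj : j ≫ sX = Spec.map (CommRingCat.ofHom (algebraMap k B)))
    (hi : i ≫ sT = Spec.map (CommRingCat.ofHom (algebraMap k R)))
    (hK : Spec.map (CommRingCat.ofHom (algebraMap B X.functionField)) ≫ j =
      X.fromSpecStalk (genericPoint X))
    (e : R →ₐ[k] k) :
    Spec.map (CommRingCat.ofHom (evalFibre B X.functionField e : R ⊗[k] B →+* X.functionField)) ≫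
      tensorToProd i j hj hi =
    X.fromSpecStalk (genericPoint X) ≫ fibreIncl sX (pointOfAlgHom i hi e) := by
  have hkK : X.fromSpecStalk (genericPoint X) ≫ sX =
      Spec.map (CommRingCat.ofHom (algebraMap k X.functionField)) := by
    rw [← hK, Category.assoc, hj, ← Spec.map_comp, ← CommRingCat.ofHom_comp,
      ← IsScalarTower.algebraMap_eq]
  apply pullback.hom_ext
  · simp only [tensorToProd, fibreIncl, Category.assoc, pullback.lift_fst, pointOfAlgHom]
    rw [reassoc_of% hkK, ← Category.assoc, ← Category.assoc, ← Spec.map_comp, ← Spec.map_comp,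
      ← CommRingCat.ofHom_comp]
    congr 3
    ext r
    change evalFibre B X.functionField e (r ⊗ₜ 1) = algebraMap k _ (e r)
    rw [evalFibre_tmul, map_one, Algebra.algebraMap_eq_smul_one]
  · simp only [tensorToProd, fibreIncl, Category.assoc, pullback.lift_snd, Category.comp_id]
    rw [← hK, ← Category.assoc, ← Spec.map_comp]
    congr 2
    ext b
    simp [evalFibre_tmul]

theorem Bir.fromFunctionField_comp [IrreducibleSpace X] (ψ : Bir sX) :
    ψ.1.fromFunctionField ≫ sX = X.fromSpecStalk (genericPoint X) ≫ sX := by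
  obtain ⟨_, e, he, rfl⟩ := ψ
  have hgs : genericPoint X ∈ e.source :=
    (genericPoint_specializes _).mem_open e.source.2 e.dense_source.nonempty.choose_spec
  change (e.source.fromSpecStalkOfMem (genericPoint X) hgs ≫ e.iso.hom ≫ e.target.ι) ≫ sX = _
  rw [Category.assoc, Category.assoc, he, Scheme.Opens.fromSpecStalkOfMem_ι_assoc]

/-- A birational map is dominant, so it sends the generic point into every nonempty open set; this
gives coordinates on any affine chart of the target. -/
theorem Bir.fromFunctionField_mem [IsIntegral X] (ψ : Bir sX) {V : X.Opens}
    (hV : (V : Set X).Nonempty) (x : Spec X.functionField) : ψ.1.fromFunctionField x ∈ V := by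
  obtain ⟨_, e, he, rfl⟩ := ψ
  let W : e.source.toScheme.Opens := (e.iso.hom ≫ e.target.ι) ⁻¹ᵁ V
  have hW : (W : Set e.source.toScheme).Nonempty := by
    obtain ⟨y, hyV, hy⟩ := e.dense_target.inter_open_nonempty V V.2 hV
    let y' : e.target.toScheme := ⟨y, hy⟩
    have h : (e.iso.inv ≫ e.iso.hom ≫ e.target.ι) y' =
        (e.iso.hom ≫ e.target.ι) (e.iso.inv y') := Scheme.Hom.comp_apply _ _ _
    rw [Iso.inv_hom_id_assoc] at h
    refine ⟨e.iso.inv y', ?_⟩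
    change (e.iso.hom ≫ e.target.ι) (e.iso.inv y') ∈ V
    rw [← h]
    exact hyV
  have hgen : genericPoint X ∈ e.source.ι ''ᵁ W := by
    refine ((genericPoint_spec X).mem_open_set_iff (e.source.ι ''ᵁ W).2).mpr ?_
    obtain ⟨w, hw⟩ := hW
    exact ⟨e.source.ι w, trivial, w, hw, rfl⟩
  have hgs : genericPoint X ∈ e.source :=
    (genericPoint_specializes _).mem_open e.source.2 e.dense_source.nonempty.choose_spec
  change (e.iso.hom ≫ e.target.ι) (e.source.fromSpecStalkOfMem _ hgs x) ∈ V
  obtain ⟨w, hw, hwg⟩ := hgen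
  have hx : e.source.fromSpecStalkOfMem _ hgs x = w := by
    apply e.source.ι.isOpenEmbedding.injective
    have h : (e.source.fromSpecStalkOfMem _ hgs ≫ e.source.ι) x =
        e.source.ι (e.source.fromSpecStalkOfMem _ hgs x) := Scheme.Hom.comp_apply _ _ _
    rw [Scheme.Opens.fromSpecStalkOfMem_ι] at h
    have hsub : Subsingleton (PrimeSpectrum X.functionField) := inferInstance
    rw [← h, hsub.elim x (IsLocalRing.closedPoint X.functionField)]
    exact Scheme.fromSpecStalk_closedPoint.trans hwg.symm
  rw [hx]
  exact hw

variable [IsOpenImmersion j] [IsIntegral X]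

theorem Bir.exists_coordHom [Nonempty (Spec (.of B))] (ψ : Bir sX) :
    ∃ γ : B →+* X.functionField,
      Spec.map (CommRingCat.ofHom γ) ≫ j = ψ.1.fromFunctionField := by
  have h : Set.range ψ.1.fromFunctionField ⊆ Set.range j := by
    rintro _ ⟨x, rfl⟩
    exact ψ.fromFunctionField_mem (V := j.opensRange) ⟨_, Classical.arbitrary _, rfl⟩ x
  refine ⟨(Spec.preimage (IsOpenImmersion.lift j ψ.1.fromFunctionField h)).hom, ?_⟩
  rw [CommRingCat.ofHom_hom, Spec.map_preimage, IsOpenImmersion.lift_fac]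

/-- The pullback of functions on an affine open subset of `X` along a birational map of `X`. -/
noncomputable def Bir.coordHom [Nonempty (Spec (.of B))] (ψ : Bir sX) : B →+* X.functionField :=
  (ψ.exists_coordHom j).choose

theorem Bir.map_coordHom_comp [Nonempty (Spec (.of B))] (ψ : Bir sX) :
    Spec.map (CommRingCat.ofHom (ψ.coordHom j)) ≫ j = ψ.1.fromFunctionField :=
  (ψ.exists_coordHom j).choose_spec

theorem Bir.ext_coordHom [Algebra k B] (hj : j ≫ sX = Spec.map (CommRingCat.ofHom (algebraMap k B)))
    [Nonempty (Spec (.of B))] {s : Set B} (hs : Algebra.adjoin k s = ⊤)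
    {ψ ψ' : Bir sX} (h : ∀ b ∈ s, ψ.coordHom j b = ψ'.coordHom j b) : ψ = ψ' := by
  have hk : (ψ.coordHom j).comp (algebraMap k B) = (ψ'.coordHom j).comp (algebraMap k B) := by
    have : Spec.map (CommRingCat.ofHom ((ψ.coordHom j).comp (algebraMap k B))) =
        Spec.map (CommRingCat.ofHom ((ψ'.coordHom j).comp (algebraMap k B))) := by
      rw [CommRingCat.ofHom_comp, CommRingCat.ofHom_comp, Spec.map_comp, Spec.map_comp, ← hj,
        ← Category.assoc, ← Category.assoc, ψ.map_coordHom_comp j, ψ'.map_coordHom_comp j,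
        ψ.fromFunctionField_comp, ψ'.fromFunctionField_comp]
    exact congr($(Spec.map_injective this).hom)
  have hall : ψ.coordHom j = ψ'.coordHom j := by
    -- The `k`-structure on the function field is taken from `ψ`; by `hk` it also makes the pullback
    -- along `ψ'` linear.
    let _ : Algebra k X.functionField := ((ψ.coordHom j).comp (algebraMap k B)).toAlgebra
    let g : B →ₐ[k] X.functionField := { ψ.coordHom j with commutes' := fun _ => rfl }
    let g' : B →ₐ[k] X.functionField :=
      { ψ'.coordHom j with commutes' := fun c => congr($(hk.symm) c) }
    have : g = g' := AlgHom.ext_of_adjoin_eq_top hs h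
    exact congr(($this : B →+* X.functionField))
  apply Subtype.ext
  apply Scheme.RationalMap.eq_of_fromFunctionField_eq
  rw [← ψ.map_coordHom_comp j, ← ψ'.map_coordHom_comp j, hall]

/-- The generic point of each fibre lies in the domain, since `U_t` is dense. Thus the single
morphism `Φ.f` computes every member of the family generically. -/
theorem PseudoAut.exists_fromFunctionField_eq (Φ : PseudoAut sT sX) (t : Points sT) :
    ∃ l : Spec X.functionField ⟶ Φ.domain.toScheme,
      l ≫ Φ.domain.ι = X.fromSpecStalk (genericPoint X) ≫ fibreIncl sX t ∧
        l ≫ Φ.f = (Φ.family t).1.fromFunctionField := by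
  refine ⟨(fibreOpen sX t Φ.domain).fromSpecStalkOfMem (genericPoint X)
    ((genericPoint_specializes _).mem_open (fibreOpen sX t Φ.domain).2
      (Φ.dense_fibre t).nonempty.choose_spec) ≫ (fibreIncl sX t) ∣_ Φ.domain, ?_, ?_⟩
  · rw [Category.assoc, morphismRestrict_ι, Scheme.Opens.fromSpecStalkOfMem_ι_assoc]
  · rw [Category.assoc]
    rfl

variable [Algebra k B] [Algebra k X.functionField] [Algebra B X.functionField]
  [IsScalarTower k B X.functionField]

/-- Locally on the base, the coordinates of a family of birational maps are quotients of functions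
on an affine chart of the product. -/
theorem PseudoAut.exists_chart (hj : j ≫ sX = Spec.map (CommRingCat.ofHom (algebraMap k B)))
    (hi : i ≫ sT = Spec.map (CommRingCat.ofHom (algebraMap k R)))
    (hK : Spec.map (CommRingCat.ofHom (algebraMap B X.functionField)) ≫ j =
      X.fromSpecStalk (genericPoint X))
    [Nonempty (Spec (.of B))] (Φ : PseudoAut sT sX) (e₀ : R →ₐ[k] k)
    {ι : Type u} [Finite ι] (b : ι → B) :
    ∃ p : Option ι → R ⊗[k] B, evalFibre B X.functionField e₀ (p none) ≠ 0 ∧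
      ∀ e, evalFibre B X.functionField e (p none) ≠ 0 → ∀ n,
        evalFibre B X.functionField e (p (some n)) = evalFibre B X.functionField e (p none) *
          (Φ.family (pointOfAlgHom i hi e)).coordHom j (b n) := by
  let m := tensorToProd i j hj hi
  let ε (e : R →ₐ[k] k) : R ⊗[k] B →+* X.functionField := evalFibre B X.functionField e
  have hm (e) : Spec.map (CommRingCat.ofHom (ε e)) ≫ m =
      X.fromSpecStalk (genericPoint X) ≫ fibreIncl sX (pointOfAlgHom i hi e) :=
    map_evalFibre_comp_tensorToProd i j hj hi hK e
  choose l hl₁ hl₂ using Φ.exists_fromFunctionField_eq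
  -- On `O` the map `f` is defined with values in the chart `Spec B`. The generic point of the fibre
  -- over `e₀` lies in `O`, hence in a basic open set `D(q)` inside it.
  let O : (Spec (.of (R ⊗[k] B))).Opens := m ⁻¹ᵁ (Φ.domain.ι ''ᵁ (Φ.f ⁻¹ᵁ j.opensRange))
  let x₀ : Spec X.functionField := IsLocalRing.closedPoint X.functionField
  have hO : Spec.map (CommRingCat.ofHom (ε e₀)) x₀ ∈ O := by
    change m (Spec.map (CommRingCat.ofHom (ε e₀)) x₀) ∈ Φ.domain.ι ''ᵁ (Φ.f ⁻¹ᵁ j.opensRange)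
    rw [← Scheme.Hom.comp_apply, hm, ← hl₁]
    refine ⟨l _ x₀, ?_, rfl⟩
    change Φ.f (l _ x₀) ∈ j.opensRange
    rw [← Scheme.Hom.comp_apply, hl₂, ← Bir.map_coordHom_comp j]
    exact ⟨_, rfl⟩
  obtain ⟨_, ⟨q, rfl⟩, hq₀, hqO⟩ :=
    PrimeSpectrum.isTopologicalBasis_basic_opens.exists_subset_of_mem_open hO O.2
  have hεq : ε e₀ q ≠ 0 := fun h0 => hq₀ (by
    change ε e₀ q ∈ x₀.asIdeal
    rw [h0]
    exact Ideal.zero_mem _)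
  let A := Localization.Away q
  let loc : Spec (.of A) ⟶ Spec (.of (R ⊗[k] B)) :=
    Spec.map (CommRingCat.ofHom (algebraMap (R ⊗[k] B) A))
  have hloc : ∀ x, loc x ∈ O := by
    intro x
    apply hqO
    exact (PrimeSpectrum.localization_away_comap_range A q).subset ⟨x, rfl⟩
  have hr₁ : Set.range (loc ≫ m) ⊆ Set.range Φ.domain.ι := by
    rintro _ ⟨x, rfl⟩
    obtain ⟨y, -, hy⟩ := hloc x
    exact ⟨y, hy⟩
  let n : Spec (.of A) ⟶ Φ.domain.toScheme := IsOpenImmersion.lift Φ.domain.ι (loc ≫ m) hr₁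
  have hn : n ≫ Φ.domain.ι = loc ≫ m := IsOpenImmersion.lift_fac _ _ _
  have hr₂ : Set.range (n ≫ Φ.f) ⊆ Set.range j := by
    rintro _ ⟨x, rfl⟩
    obtain ⟨y, hyj, hy⟩ := hloc x
    have : n x = y := by
      apply Φ.domain.ι.isOpenEmbedding.injective
      rw [← Scheme.Hom.comp_apply, hn]
      exact hy.symm
    rw [Scheme.Hom.comp_apply, this]
    exact hyj
  let w : Spec (.of A) ⟶ Spec (.of B) := IsOpenImmersion.lift j (n ≫ Φ.f) hr₂
  have hw : w ≫ j = n ≫ Φ.f := IsOpenImmersion.lift_fac _ _ _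
  let F : B →+* A := (Spec.preimage w).hom
  have hF : Spec.map (CommRingCat.ofHom F) = w := Spec.map_preimage w
  obtain ⟨d, hd⟩ := IsLocalization.exist_integer_multiples_of_finite (Submonoid.powers q)
    fun a => F (b a)
  choose c hc using hd
  -- The common denominator `d` is a power of `q`, possibly `1`; the extra factor `q` ensures that a
  -- nonzero denominator on a fibre puts its generic point in `D(q)`.
  refine ⟨fun o => o.elim (q * d) fun a => q * c a, ?_, ?_⟩
  · obtain ⟨N, hN⟩ := d.2
    change ε e₀ (q * d) ≠ 0
    rw [← hN, map_mul, map_pow]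
    exact mul_ne_zero hεq (pow_ne_zero _ hεq)
  · intro e he a
    have heq : ε e q ≠ 0 := by
      intro h0
      apply he
      change ε e (q * d) = 0
      rw [map_mul, h0, zero_mul]
    have hunit : IsUnit (ε e q) := isUnit_iff_ne_zero.mpr heq
    let ε' : A →+* X.functionField := IsLocalization.Away.lift q hunit
    have hε' : ∀ z, ε' (algebraMap _ A z) = ε e z := IsLocalization.Away.lift_eq q hunit
    have h1 : Spec.map (CommRingCat.ofHom ε') ≫ loc = Spec.map (CommRingCat.ofHom (ε e)) := by
      rw [← Spec.map_comp, ← CommRingCat.ofHom_comp]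
      congr 2
      exact RingHom.ext hε'
    have h2 : Spec.map (CommRingCat.ofHom ε') ≫ n = l (pointOfAlgHom i hi e) := by
      rw [← cancel_mono Φ.domain.ι, Category.assoc, hn, ← Category.assoc, h1, hm, hl₁]
    have h3 : Spec.map (CommRingCat.ofHom ε') ≫ w =
        Spec.map (CommRingCat.ofHom ((Φ.family (pointOfAlgHom i hi e)).coordHom j)) := by
      rw [← cancel_mono j, Category.assoc, hw, ← Category.assoc, h2, hl₂, Bir.map_coordHom_comp]
    have h4 : ε' (F (b a)) = (Φ.family (pointOfAlgHom i hi e)).coordHom j (b a) := by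
      rw [← hF, ← Spec.map_comp] at h3
      exact congr($(Spec.map_injective h3).hom (b a))
    change ε e (q * c a) = ε e (q * d) * _
    rw [map_mul, map_mul, ← h4, ← hε' (c a), hc, mul_assoc]
    simp only [Algebra.smul_def, map_mul, hε']

end Scheme

/-! ### Affine charts, classical points and closed subsets of `Bir(X)` -/

section

variable {k : Type u} [Field k] {T X : Scheme.{u}} {sT : T ⟶ Spec (.of k)} {sX : X ⟶ Spec (.of k)}

theorem finiteType_of_isOpenImmersion [LocallyOfFiniteType sX] {B : Type u} [CommRing B]
    [Algebra k B] (j : Spec (.of B) ⟶ X) [IsOpenImmersion j]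
    (hj : j ≫ sX = Spec.map (CommRingCat.ofHom (algebraMap k B))) : Algebra.FiniteType k B := by
  have h : LocallyOfFiniteType (j ≫ sX) := inferInstance
  rw [hj, HasRingHomProperty.Spec_iff (P := @LocallyOfFiniteType)] at h
  exact RingHom.finiteType_algebraMap.mp h

variable (sX) in
theorem exists_affine_nhds (x : X) : ∃ (B : Type u) (_ : CommRing B) (_ : Algebra k B)
    (j : Spec (.of B) ⟶ X), IsOpenImmersion j ∧
      j ≫ sX = Spec.map (CommRingCat.ofHom (algebraMap k B)) ∧ x ∈ Set.range j := by
  obtain ⟨U, hU, hxU, -⟩ := exists_isAffineOpen_mem_and_subset (X := X) (x := x) (U := ⊤) trivial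
  let κ : CommRingCat.of k ⟶ Γ(X, U) := Spec.preimage (hU.fromSpec ≫ sX)
  refine ⟨Γ(X, U), inferInstance, κ.hom.toAlgebra, hU.fromSpec, inferInstance, ?_, ?_⟩
  · exact (Spec.map_preimage _).symm
  · rw [hU.range_fromSpec]
    exact hxU

variable (sX) in
theorem exists_affine_generic [IsIntegral X] : ∃ (B : Type u) (_ : CommRing B) (_ : Algebra k B)
    (_ : Algebra k X.functionField) (_ : Algebra B X.functionField)
    (_ : IsScalarTower k B X.functionField) (j : Spec (.of B) ⟶ X),
    FaithfulSMul B X.functionField ∧ IsOpenImmersion j ∧ Nonempty (Spec (.of B)) ∧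
      j ≫ sX = Spec.map (CommRingCat.ofHom (algebraMap k B)) ∧
      Spec.map (CommRingCat.ofHom (algebraMap B X.functionField)) ≫ j =
        X.fromSpecStalk (genericPoint X) := by
  obtain ⟨U, hU, hxU, -⟩ := exists_isAffineOpen_mem_and_subset (X := X) (x := genericPoint X)
    (U := ⊤) trivial
  let κ : CommRingCat.of k ⟶ Γ(X, U) := Spec.preimage (hU.fromSpec ≫ sX)
  let β : Γ(X, U) ⟶ X.functionField := X.presheaf.germ U (genericPoint X) hxU
  let a₁ : Algebra k Γ(X, U) := κ.hom.toAlgebra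
  let a₂ : Algebra k X.functionField := (β.hom.comp κ.hom).toAlgebra
  let a₃ : Algebra Γ(X, U) X.functionField := β.hom.toAlgebra
  refine ⟨Γ(X, U), inferInstance, a₁, a₂, a₃, ?_, hU.fromSpec, ?_, inferInstance, ?_, ?_, ?_⟩
  · exact IsScalarTower.of_algebraMap_eq' rfl
  · exact (faithfulSMul_iff_algebraMap_injective _ _).mpr (germ_injective_of_isIntegral X _ hxU)
  · obtain ⟨y, -⟩ : genericPoint X ∈ Set.range hU.fromSpec := by
      rw [hU.range_fromSpec]
      exact hxU
    exact ⟨y⟩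
  · exact (Spec.map_preimage _).symm
  · exact hU.fromSpecStalk_eq_fromSpecStalk hxU

variable {R : Type u} [CommRing R] [Algebra k R] (i : Spec (.of R) ⟶ T)
  (hi : i ≫ sT = Spec.map (CommRingCat.ofHom (algebraMap k R)))

/-- The point of the scheme `T` underlying a classical point. -/
noncomputable def Points.toScheme (t : Points sT) : T :=
  t.1 (IsLocalRing.closedPoint k)

theorem Points.isInducing_toScheme : Topology.IsInducing (Points.toScheme (sT := sT)) :=
  ⟨rfl⟩

theorem toScheme_pointOfAlgHom (e : R →ₐ[k] k) :
    (pointOfAlgHom i hi e).toScheme = i (ratPoint e) := by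
  have : (IsLocalRing.closedPoint k : PrimeSpectrum k) = ⊥ := Subsingleton.elim _ _
  change (Spec.map (CommRingCat.ofHom (e : R →+* k)) ≫ i) (IsLocalRing.closedPoint k) = _
  refine (Scheme.Hom.comp_apply _ _ _).trans ?_
  rw [this]
  rfl

theorem pointOfAlgHom_injective [IsOpenImmersion i] :
    Function.Injective (pointOfAlgHom (sT := sT) i hi) := by
  intro e e' h
  apply ratPoint_injective
  apply i.isOpenEmbedding.injective
  rw [← toScheme_pointOfAlgHom i hi, h, toScheme_pointOfAlgHom]

theorem exists_pointOfAlgHom_eq [IsOpenImmersion i] {t : Points sT}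
    (ht : t.toScheme ∈ Set.range i) : ∃ e, pointOfAlgHom i hi e = t := by
  have hr : Set.range t.1 ⊆ Set.range i := by
    rintro _ ⟨x, rfl⟩
    have hsub : Subsingleton (PrimeSpectrum k) := inferInstance
    rw [hsub.elim x (IsLocalRing.closedPoint k)]
    exact ht
  let g : CommRingCat.of R ⟶ CommRingCat.of k := Spec.preimage (IsOpenImmersion.lift i t.1 hr)
  have hg : Spec.map g ≫ i = t.1 := by
    rw [Spec.map_preimage, IsOpenImmersion.lift_fac]
  have hgk : CommRingCat.ofHom (algebraMap k R) ≫ g = 𝟙 _ := by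
    apply Spec.map_injective
    rw [Spec.map_comp, ← hi, reassoc_of% hg, t.2, Spec.map_id]
  exact ⟨{ g.hom with commutes' := fun c => congr($(hgk).hom c) }, Subtype.ext hg⟩

theorem isOpen_setOf_pointOfAlgHom [IsOpenImmersion i] {W : Set (PrimeSpectrum R)}
    (hW : IsOpen W) :
    IsOpen {t : Points sT | ∃ e, pointOfAlgHom i hi e = t ∧ ratPoint e ∈ W} := by
  refine Points.isInducing_toScheme.isOpen_iff.mpr
    ⟨i '' W, i.isOpenEmbedding.isOpenMap _ hW, ?_⟩
  ext t
  constructor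
  · rintro ⟨w, hw, hwt⟩
    obtain ⟨e, rfl⟩ := exists_pointOfAlgHom_eq i hi (t := t) ⟨w, hwt⟩
    rw [toScheme_pointOfAlgHom] at hwt
    obtain rfl := i.isOpenEmbedding.injective hwt
    exact ⟨e, rfl, hw⟩
  · rintro ⟨e, rfl, he⟩
    exact ⟨ratPoint e, he, (toScheme_pointOfAlgHom i hi e).symm⟩

instance [IsVariety sT] : TopologicalSpace.NoetherianSpace (Points sT) := by
  have := IsVariety.locallyOfFiniteType (sX := sT)
  have := IsVariety.quasiCompact (sX := sT)
  have : CompactSpace T := QuasiCompact.compactSpace_of_compactSpace sT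
  have : IsNoetherian T := { __ := LocallyOfFiniteType.isLocallyNoetherian sT }
  exact Points.isInducing_toScheme.noetherianSpace

/-- An element of `K` is nonzero when some linear functional detects it, and each functional of the
value is given by an element of `R`; so `N` is a union of basic open sets. -/
theorem exists_isOpen_evalFibre_ne_zero {B K : Type u} [CommRing B] [Algebra k B] [CommRing K]
    [Algebra k K] [Algebra B K] [IsScalarTower k B K] (q : R ⊗[k] B) :
    ∃ N : Set (PrimeSpectrum R), IsOpen N ∧
      ∀ e : R →ₐ[k] k, ratPoint e ∈ N ↔ evalFibre B K e q ≠ 0 := by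
  choose r hr using isRegularVec_evalFibre (K := K) (fun e : R →ₐ[k] k => e) q
  refine ⟨⋃ l, PrimeSpectrum.basicOpen (r l), isOpen_iUnion fun l => (PrimeSpectrum.basicOpen _).2,
    fun e => ?_⟩
  rw [Set.mem_iUnion, ne_eq, ← Module.forall_dual_apply_eq_zero_iff k, not_forall]
  refine exists_congr fun l => ?_
  rw [hr l e]
  rfl

variable {B : Type u} [CommRing B] [Algebra k B] (j : Spec (.of B) ⟶ X) [IsOpenImmersion j]
  [IsIntegral X] [Nonempty (Spec (.of B))] [Algebra k X.functionField] [Algebra B X.functionField]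
  [IsScalarTower k B X.functionField]

/-- The coordinates of a birational map with respect to finitely many functions on an affine open
subset of `X`. -/
noncomputable def Bir.coords {ι : Type u} (b : ι → B) (ψ : Bir sX) (n : ι) : X.functionField :=
  ψ.coordHom j (b n)

/-- Closedness of the preimage in `T` is local on `T`, and near each of its points a family is a
chart. -/
theorem Bir.isClosed_of_charts (hj : j ≫ sX = Spec.map (CommRingCat.ofHom (algebraMap k B)))
    (hK : Spec.map (CommRingCat.ofHom (algebraMap B X.functionField)) ≫ j =
      X.fromSpecStalk (genericPoint X)) {ι : Type u} [Finite ι] (b : ι → B) (F : Set (Bir sX))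
    (hF : ∀ (S R : Type u) [TopologicalSpace S] [CommRing R] [Algebra k R]
      (ev : S → R →ₐ[k] k) (p : Option ι → R ⊗[k] B) (ψ : S → Bir sX),
        IsChart (Bir.coords j b) ev p ψ → IsClosed (ψ ⁻¹' F)) : IsClosed F := by
  have hZ : IsZariskiClosed F := by
    rintro T sT hT φ ⟨Φ, rfl⟩
    rw [← isOpen_compl_iff, isOpen_iff_mem_nhds]
    intro t₀ ht₀
    obtain ⟨R, _, _, i, _, hi, hti⟩ := exists_affine_nhds sT t₀.toScheme
    obtain ⟨e₀, rfl⟩ := exists_pointOfAlgHom_eq i hi hti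
    obtain ⟨p, hp₀, hp⟩ := Φ.exists_chart i j hj hi hK e₀ b
    obtain ⟨N, hN, hNe⟩ := exists_isOpen_evalFibre_ne_zero (K := X.functionField) (p none)
    let S : Set (Points sT) := {t | ∃ e, pointOfAlgHom i hi e = t ∧ ratPoint e ∈ N}
    have hS : IsOpen S := isOpen_setOf_pointOfAlgHom i hi hN
    choose ev hev hevN using fun t : S => t.2
    have hchart : IsChart (Bir.coords j b) ev p fun t : S => Φ.family t.1 := by
      refine ⟨fun r => ?_, fun t => (hNe _).mp (hevN t), fun t n => ?_⟩
      · have := (isOpen_setOf_pointOfAlgHom (sT := sT) i hi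
          (PrimeSpectrum.basicOpen r).2).preimage (continuous_subtype_val (p := (· ∈ S)))
        convert this using 1
        ext t
        constructor
        · exact fun h => ⟨ev t, hev t, h⟩
        · rintro ⟨e, he, her⟩
          obtain rfl := pointOfAlgHom_injective i hi (he.trans (hev t).symm)
          exact her
      · rw [hp _ ((hNe _).mp (hevN t)), hev t]
        rfl
    have hcl := hF S R ev p _ hchart
    refine Filter.mem_of_superset ((hS.isOpenMap_subtype_val _ hcl.isOpen_compl).mem_nhds
      ⟨⟨_, e₀, rfl, (hNe e₀).mpr hp₀⟩, ht₀, rfl⟩) ?_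
    rintro _ ⟨t, ht, rfl⟩
    exact ht
  rw [← isOpen_compl_iff]
  change Fᶜᶜ ∈ {F | IsZariskiClosed F}
  rwa [compl_compl]

end

/-- The image of a constructible set under a morphism to `Bir(X)` is constructible. -/
theorem IsMorphism.isConstructibleSet_image {k : Type u} [Field k] [IsAlgClosed k]
    {T X : Scheme.{u}} {sT : T ⟶ Spec (.of k)} {sX : X ⟶ Spec (.of k)} [IsIntegral X]
    [IsVariety sX] [IsVariety sT]
    {φ : Points sT → Bir sX} (hφ : IsMorphism φ) {C : Set (Points sT)}
    (hC : IsConstructibleSet C) : IsConstructibleSet (φ '' C) := by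
  obtain ⟨Φ, rfl⟩ := hφ
  have := IsVariety.locallyOfFiniteType (sX := sX)
  have := IsVariety.locallyOfFiniteType (sX := sT)
  obtain ⟨B, _, _, _, _, _, j, _, _, _, hj, hK⟩ := exists_affine_generic sX
  obtain ⟨s, hs⟩ := (finiteType_of_isOpenImmersion j hj).out
  obtain ⟨D, hD, rfl⟩ := hC.exists_preimage_eq Points.isInducing_toScheme
  let b : s → B := Subtype.val
  have hchart : ∀ t₀ : Points sT, ∃ S : Set (Points sT), IsOpen S ∧ t₀ ∈ S ∧
      IsConstructibleSet (Φ.family '' (Points.toScheme ⁻¹' D ∩ S)) := by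
    intro t₀
    obtain ⟨R, _, _, i, _, hi, hti⟩ := exists_affine_nhds sT t₀.toScheme
    have := finiteType_of_isOpenImmersion i hi
    obtain ⟨e₀, rfl⟩ := exists_pointOfAlgHom_eq i hi hti
    obtain ⟨p, hp₀, hp⟩ := Φ.exists_chart i j hj hi hK e₀ b
    obtain ⟨N, hN, hNe⟩ := exists_isOpen_evalFibre_ne_zero (K := X.functionField) (p none)
    refine ⟨{t | ∃ e, pointOfAlgHom i hi e = t ∧ ratPoint e ∈ N},
      isOpen_setOf_pointOfAlgHom i hi hN, ⟨e₀, rfl, (hNe e₀).mpr hp₀⟩, ?_⟩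
    have hDN : IsConstructibleSet (i ⁻¹' D ∩ N : Set (PrimeSpectrum R)) :=
      (hD.preimage i.continuous).inter_isLocallyClosed hN.isLocallyClosed
    convert isConstructibleSet_of_chart (Bir.isClosed_of_charts j hj hK b) p hDN
      (fun e he => (hNe e).mp he.2) using 1
    ext ψ
    constructor
    · rintro ⟨_, ⟨hD, e, rfl, he⟩, rfl⟩
      refine ⟨e, ⟨?_, he⟩, hp e ((hNe e).mp he)⟩
      rwa [Set.mem_preimage, toScheme_pointOfAlgHom] at hD
    · rintro ⟨e, ⟨heD, heN⟩, he⟩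
      refine ⟨pointOfAlgHom i hi e, ⟨?_, e, rfl, heN⟩, ?_⟩
      · rwa [Set.mem_preimage, toScheme_pointOfAlgHom]
      -- Both maps have the same numerators over the same nonzero denominator, hence equal
      -- coordinates on generators of `B`.
      · refine Bir.ext_coordHom j hj hs fun c hc => ?_
        have h := (hp e ((hNe e).mp heN) ⟨c, hc⟩).symm.trans (he ⟨c, hc⟩)
        exact mul_left_cancel₀ ((hNe e).mp heN) h
  choose S hS hmem hSC using hchart
  -- The space of classical points of `T` is Noetherian, so finitely many charts suffice.
  obtain ⟨I, hI⟩ := isCompact_univ.elim_finite_subcover S hS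
    fun t _ => Set.mem_iUnion.mpr ⟨t, hmem t⟩
  have hunion : Φ.family '' (Points.toScheme ⁻¹' D) =
      ⋃ t : I, Φ.family '' (Points.toScheme ⁻¹' D ∩ S t) := by
    rw [← Set.image_iUnion, ← Set.inter_iUnion, Set.inter_eq_left.mpr]
    intro t _
    simpa using hI (Set.mem_univ t)
  rw [hunion]
  exact .iUnion fun t => hSC t

end BirFamilies

theorem theorem34 {k : Type u} [Field k] [IsAlgClosed k]
    {X : Scheme.{u}} (sX : X ⟶ Spec (.of k)) [BirFamilies.IsVariety sX] [IrreducibleSpace X]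
    [Scheme.IsRationalOver sX]
    {T : Scheme.{u}} (sT : T ⟶ Spec (.of k)) [BirFamilies.IsVariety sT]
    (φ : BirFamilies.Points sT → BirFamilies.Bir sX) (hφ : BirFamilies.IsMorphism φ)
    (C : Set (BirFamilies.Points sT)) (hC : BirFamilies.IsConstructibleSet C) :
    BirFamilies.IsConstructibleSet (φ '' C) ∧
      ∃ O : Set ↥(closure (φ '' C)), IsOpen O ∧ Dense O ∧ Subtype.val '' O ⊆ φ '' C := by
  have := BirFamilies.IsVariety.isReduced (sX := sX)
  have := isIntegral_of_irreducibleSpace_of_isReduced X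
  have h := hφ.isConstructibleSet_image hC
  exact ⟨h, h.exists_isOpen_dense⟩
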